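/- Let $h_1,h_2,\dots$ be i.i.d. real random variables on a probability space $(\Omega,\mathcal F,\mathbb P)$ with $\mathbb E[e^{t h_1}]<\infty$ for all $t\in\mathbb R$. For every $N\ge 1$ let $\Sigma_N=\{-1,+1\}^N$ and let $X_N=(X_N(\sigma))_{\sigma\in\Sigma_N}$ be i.i.d. centered Gaussian random variables of variance $N$ on the same space, independent of the sequence $(h_i)_{i\ge1}$. (Nothing is assumed about the joint law of $X_N$ for different $N$.) Put $$H_N(\sigma)=X_N(\sigma)+\sum_{i=1}^N h_i\sigma_i ,\qquad \sigma\in\Sigma_N .$$ Then $\log\cosh(t h_1)$ and $h_1\tanh(t h_1)$ are integrable for every $t\in\mathbb R$, and there is exactly one real number $\beta_c$ that satisfies the self-consistency equation $$\beta_c=\sqrt{2\Big(\log 2-\big(\beta_c\,\mathbb E[h_1\tanh(\beta_c h_1)]-\mathbb E[\log\cosh(\beta_c h_1)]\big)\Big)}$$ (with nonnegative radicand); moreover $\beta_c>0$. With $$E_{\max}:=\beta_c+\mathbb E[h_1\tanh(\beta_c h_1)],$$ for every $\beta>0$, $\mathbb P$-almost surely, $$\lim_{N\to\infty}\frac1N\log\sum_{\sigma\in\Sigma_N}\exp\big(\beta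 H_N(\sigma)\big)=\begin{cases}\log 2+\dfrac{\beta^2}{2}+\mathbb E[\log\cosh(\beta h_1)] & \text{if }\beta\le\beta_c,\\[1ex] E_{\max}\,\beta & \text{if }\beta\ge\beta_c.\end{cases}$$ -/

import Mathlib

open MeasureTheory ProbabilityTheory Filter Topology

noncomputable section

namespace RandomFieldREM

/-- The hypercube `{-1, +1}^N`; `ℤˣ = {1, -1}` is the set of spin values. -/
abbrev Config (N : ℕ) : Type := Fin N → ℤˣ

/-- The random field energy `∑_{i < N} h_i σ_i` for a realization `h` of the field
(the field is indexed from `0`, so that `h 0` is the first field variable). -/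
def fieldEnergy (N : ℕ) (h : ℕ → ℝ) (σ : Config N) : ℝ :=
  ∑ i : Fin N, h i * ((σ i : ℤ) : ℝ)

/-- The Hamiltonian `H_N(σ) = X_N(σ) + ∑_{i < N} h_i σ_i`, for realizations `x` of the
REM energies at size `N` and `h` of the field. -/
def hamiltonian (N : ℕ) (x : Config N → ℝ) (h : ℕ → ℝ) (σ : Config N) : ℝ :=
  x σ + fieldEnergy N h σ

/-- The free energy `(1/N) log ∑_σ exp (β H_N(σ))`. -/
def freeEnergy (N : ℕ) (x : Config N → ℝ) (h : ℕ → ℝ) (β : ℝ) : ℝ :=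
  1 / (N : ℝ) * Real.log (∑ σ : Config N, Real.exp (β * hamiltonian N x h σ))

variable {Ω : Type*} [MeasurableSpace Ω]

/-- `E[log cosh (t Y)]` for a real random variable `Y`. -/
def meanLogCosh (P : Measure Ω) (Y : Ω → ℝ) (t : ℝ) : ℝ :=
  ∫ ω, Real.log (Real.cosh (t * Y ω)) ∂P

/-- `E[Y tanh (t Y)]` for a real random variable `Y`. -/
def meanTanh (P : Measure Ω) (Y : Ω → ℝ) (t : ℝ) : ℝ :=
  ∫ ω, Y ω * Real.tanh (t * Y ω) ∂P

/-- The self-consistency equation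
`b = √(2 (log 2 - (b E[Y tanh (b Y)] - E[log cosh (b Y)])))`, with nonnegative radicand. -/
def SelfConsistent (P : Measure Ω) (Y : Ω → ℝ) (b : ℝ) : Prop :=
  0 ≤ 2 * (Real.log 2 - (b * meanTanh P Y b - meanLogCosh P Y b)) ∧
    b = Real.sqrt (2 * (Real.log 2 - (b * meanTanh P Y b - meanLogCosh P Y b)))

end RandomFieldREM

end

/-!
Write `f β = log 2 + β ^ 2 / 2 + E[log cosh (β h₁)]` (`annealedLimit`) for the limit of the free
energy obtained by averaging the partition function `Z` over the Gaussian energies in a fixed field;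
by the law of large numbers in the field this limit exists almost surely. The function `f` is convex
with derivative `f' β = β + E[h₁ tanh (β h₁)]` (`annealedSlope`), and all that is needed about the
field follows from the tangent inequality `annealedLimit_tangent` and the continuity of `f'`. The
intercept at `0` of the tangent to `f` at `β`, `tangentIntercept β = f β - β f' β`, is strictly
decreasing in `β > 0`, and the self-consistency equation says that it vanishes. So `βc` is unique,
the intercept is positive below `βc`, and the tangent at `βc` is the line `β ↦ Emax β`.

*Upper bound.* In a fixed field, Markov's inequality bounds the probability that `Z` exceeds its
mean by an exponential factor, which gives `limsup ≤ f β` for every `β`. For `β ≥ βc`, the `ℓ^p`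
norm of the Boltzmann weights decreases in `p`, so the free energy at `β` is at most `β / βc` times
that at `βc`, hence at most `Emax β` in the limit.

*Lower bound below `βc`.* A sum of independent nonnegative variables of total mean `1` rarely drops
below `1 / 2` if for some `p ∈ (1, 2]` its summands have small `p`-th moments
(`measureReal_sum_le_half`). For the Boltzmann weights divided by the mean of `Z`, the sum of the
`p`-th moments has exponential rate `f (p β) - p f β`, whose derivative at `p = 1` is
`-tangentIntercept β`. Below `βc` it is therefore exponentially small for `p` slightly above `1`.

*Lower bound above `βc`.* The free energy is convex in `β`, so chords over `[a, b]` with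
`a < b < βc` bound it from below at `β ≥ βc`; as `a` and `b` tend to `βc` the bound tends to the
value at `β` of the tangent to `f` at `βc`.

The exceptional probabilities are summable uniformly in the field, so Borel–Cantelli applies using
only the independence of the energies and the field for each single `N`
(`ae_eventually_notMem_of_indepFun`).
-/

namespace RandomFieldREM

/-! ### The function `log cosh` and its expectation -/

theorem continuous_tanh : Continuous Real.tanh := by
  simp only [funext Real.tanh_eq_sinh_div_cosh]
  exact Real.continuous_sinh.div Real.continuous_cosh fun x => (Real.cosh_pos x).ne'

theorem continuous_log_cosh : Continuous fun x => Real.log (Real.cosh x) :=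
  Real.continuous_cosh.log fun x => (Real.cosh_pos x).ne'

/-- The graph of the convex function `log cosh` lies above its tangents. -/
theorem log_cosh_tangent (x y : ℝ) :
    Real.log (Real.cosh y) + (x - y) * Real.tanh y ≤ Real.log (Real.cosh x) := by
  have hy := Real.cosh_pos y
  rw [Real.le_log_iff_exp_le (Real.cosh_pos x), Real.exp_add, Real.exp_log hy]
  set d := x - y with hd
  set s := Real.tanh y with hs
  have h1 : s < 1 := Real.tanh_lt_one y
  have h2 : -1 < s := Real.neg_one_lt_tanh y
  -- `cosh x / cosh y` averages `exp d` and `exp (-d)` with mean exponent `d * tanh y`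
  have hconv := convexOn_exp.2 (Set.mem_univ d) (Set.mem_univ (-d))
    (by linarith : 0 ≤ (1 + s) / 2) (by linarith : 0 ≤ (1 - s) / 2) (by ring)
  simp only [smul_eq_mul] at hconv
  have hx : Real.cosh x = Real.cosh y * ((1 + s) / 2 * Real.exp d + (1 - s) / 2 * Real.exp (-d)) := by
    have : x = y + d := by rw [hd]; ring
    rw [this, Real.cosh_add, Real.cosh_eq d, Real.sinh_eq d, hs, Real.tanh_eq_sinh_div_cosh]
    field_simp
    ring
  rw [hx]
  refine mul_le_mul_of_nonneg_left ?_ hy.le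
  convert hconv using 2
  ring

theorem log_cosh_nonneg (x : ℝ) : 0 ≤ Real.log (Real.cosh x) :=
  Real.log_nonneg (Real.one_le_cosh x)

theorem log_cosh_le_abs (x : ℝ) : Real.log (Real.cosh x) ≤ |x| := by
  have h := log_cosh_tangent 0 x
  simp only [Real.cosh_zero, Real.log_one, zero_sub] at h
  have : |x * Real.tanh x| ≤ |x| * 1 := by
    rw [abs_mul]
    exact mul_le_mul_of_nonneg_left (Real.abs_tanh_lt_one x).le (abs_nonneg x)
  linarith [le_abs_self (x * Real.tanh x)]

section Expectations

variable {Ω : Type*} [MeasurableSpace Ω] {P : Measure Ω} {Y : Ω → ℝ}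

theorem integrable_of_integrable_exp (hY : Measurable Y)
    (hexp : ∀ t : ℝ, Integrable (fun ω => Real.exp (t * Y ω)) P) : Integrable Y P := by
  refine ((hexp 1).add (hexp (-1))).mono' hY.aestronglyMeasurable (ae_of_all _ fun ω => ?_)
  simp only [Pi.add_apply, Real.norm_eq_abs]
  rcases abs_cases (Y ω) with ⟨h, -⟩ | ⟨h, -⟩ <;> rw [h]
  · linarith [Real.add_one_le_exp (1 * Y ω), Real.exp_pos (-1 * Y ω)]
  · linarith [Real.add_one_le_exp (-1 * Y ω), Real.exp_pos (1 * Y ω)]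

theorem integrable_log_cosh (hY : Integrable Y P) (t : ℝ) :
    Integrable (fun ω => Real.log (Real.cosh (t * Y ω))) P := by
  refine (hY.const_mul t).abs.mono'
    (continuous_log_cosh.comp_aestronglyMeasurable (hY.const_mul t).aestronglyMeasurable)
    (ae_of_all _ fun ω => ?_)
  rw [Real.norm_eq_abs, abs_of_nonneg (log_cosh_nonneg _)]
  exact log_cosh_le_abs _

theorem abs_mul_tanh_le (x y : ℝ) : |x * Real.tanh y| ≤ |x| := by
  rw [abs_mul]
  exact mul_le_of_le_one_right (abs_nonneg x) (Real.abs_tanh_lt_one y).le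

theorem integrable_mul_tanh (hY : Integrable Y P) (t : ℝ) :
    Integrable (fun ω => Y ω * Real.tanh (t * Y ω)) P :=
  hY.abs.mono' (hY.aestronglyMeasurable.mul
    (continuous_tanh.comp_aestronglyMeasurable (hY.const_mul t).aestronglyMeasurable))
    (ae_of_all _ fun _ => abs_mul_tanh_le _ _)

theorem continuous_meanTanh (hY : Integrable Y P) : Continuous (meanTanh P Y) := by
  refine continuous_of_dominated (fun t => (integrable_mul_tanh hY t).aestronglyMeasurable)
    (fun t => ae_of_all _ fun ω => abs_mul_tanh_le _ _) hY.abs (ae_of_all _ fun _ => ?_)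
  exact continuous_const.mul (continuous_tanh.comp (continuous_id.mul continuous_const))

theorem meanLogCosh_zero : meanLogCosh P Y 0 = 0 := by simp [meanLogCosh]

/-- `meanTanh` is a subgradient of the convex function `meanLogCosh`. -/
theorem meanLogCosh_tangent (hY : Integrable Y P) (s t : ℝ) :
    meanLogCosh P Y t + (s - t) * meanTanh P Y t ≤ meanLogCosh P Y s := by
  unfold meanLogCosh meanTanh
  rw [← integral_const_mul, ← integral_add (integrable_log_cosh hY t)
    ((integrable_mul_tanh hY t).const_mul _)]
  refine integral_mono ((integrable_log_cosh hY t).add ((integrable_mul_tanh hY t).const_mul _))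
    (integrable_log_cosh hY s) fun ω => ?_
  have := log_cosh_tangent (s * Y ω) (t * Y ω)
  simp only
  linarith

theorem monotone_meanTanh (hY : Integrable Y P) : Monotone (meanTanh P Y) := by
  intro s t hst
  rcases hst.eq_or_lt with rfl | hlt
  · rfl
  have h1 := meanLogCosh_tangent hY s t
  have h2 := meanLogCosh_tangent hY t s
  have : 0 ≤ (t - s) * (meanTanh P Y t - meanTanh P Y s) := by linarith
  linarith [nonneg_of_mul_nonneg_right this (sub_pos.2 hlt)]

end Expectations

/-! ### The limiting annealed free energy and the critical point -/

section Critical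

variable {Ω : Type*} [MeasurableSpace Ω] (P : Measure Ω) (Y : Ω → ℝ)

/-- The limit `log 2 + t ^ 2 / 2 + E[log cosh (t Y)]` of the annealed free energies. -/
noncomputable def annealedLimit (t : ℝ) : ℝ := Real.log 2 + t ^ 2 / 2 + meanLogCosh P Y t

/-- The derivative `t + E[Y tanh (t Y)]` of `annealedLimit`. -/
noncomputable def annealedSlope (t : ℝ) : ℝ := t + meanTanh P Y t

variable {P Y}

theorem continuous_annealedSlope (hY : Integrable Y P) : Continuous (annealedSlope P Y) :=
  continuous_id.add (continuous_meanTanh hY)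

theorem annealedLimit_tangent (hY : Integrable Y P) (s t : ℝ) :
    annealedLimit P Y t + (s - t) * annealedSlope P Y t ≤ annealedLimit P Y s := by
  have := meanLogCosh_tangent hY s t
  unfold annealedLimit annealedSlope
  nlinarith [sq_nonneg (s - t)]

/-- By the tangent inequality at `s` and at `t`, `annealedLimit s` lies between two functions of `s`
that agree with it at `s = t`. -/
theorem continuous_annealedLimit (hY : Integrable Y P) : Continuous (annealedLimit P Y) := by
  rw [continuous_iff_continuousAt]
  intro t
  have hslope := (continuous_annealedSlope hY).tendsto t
  have hsub : Tendsto (fun s : ℝ => s - t) (𝓝 t) (𝓝 0) := by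
    have h : Continuous fun s : ℝ => s - t := by fun_prop
    simpa using h.tendsto t
  have hlo : Tendsto (fun s => annealedLimit P Y t + (s - t) * annealedSlope P Y t) (𝓝 t)
      (𝓝 (annealedLimit P Y t)) := by
    simpa using (hsub.mul_const (annealedSlope P Y t)).const_add (annealedLimit P Y t)
  have hhi : Tendsto (fun s => annealedLimit P Y t + (s - t) * annealedSlope P Y s) (𝓝 t)
      (𝓝 (annealedLimit P Y t)) := by
    simpa using (hsub.mul hslope).const_add (annealedLimit P Y t)
  refine tendsto_of_tendsto_of_tendsto_of_le_of_le hlo hhi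
    (fun s => annealedLimit_tangent hY s t) fun s => ?_
  have := annealedLimit_tangent hY t s
  simp only
  linarith

theorem annealedSlope_sub_le (hY : Integrable Y P) {s t : ℝ} (hst : s ≤ t) :
    annealedSlope P Y s + (t - s) ≤ annealedSlope P Y t := by
  have := monotone_meanTanh hY hst
  unfold annealedSlope
  linarith

variable (P Y) in
/-- The value at `0` of the tangent to `annealedLimit` at `t`. It is the entropy
`log 2 - t ^ 2 / 2 - (t E[Y tanh (t Y)] - E[log cosh (t Y)])` of the configurations that carry
the partition function at inverse temperature `t`. -/
noncomputable def tangentIntercept (t : ℝ) : ℝ := annealedLimit P Y t - t * annealedSlope P Y t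

theorem strictAntiOn_tangentIntercept (hY : Integrable Y P) :
    StrictAntiOn (tangentIntercept P Y) (Set.Ioi 0) := by
  intro s hs t _ hst
  have h1 := annealedLimit_tangent hY s t
  have h2 := annealedSlope_sub_le hY hst.le
  have h3 : s * annealedSlope P Y s < s * annealedSlope P Y t :=
    mul_lt_mul_of_pos_left (by linarith) hs
  unfold tangentIntercept
  linarith

theorem tangentIntercept_zero : tangentIntercept P Y 0 = Real.log 2 := by
  simp [tangentIntercept, annealedLimit, meanLogCosh_zero]

theorem selfConsistent_iff (b : ℝ) :
    SelfConsistent P Y b ↔ 0 ≤ b ∧ tangentIntercept P Y b = 0 := by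
  unfold SelfConsistent tangentIntercept annealedLimit annealedSlope
  constructor
  · rintro ⟨h1, h2⟩
    refine ⟨h2 ▸ Real.sqrt_nonneg _, ?_⟩
    have h3 := Real.sq_sqrt h1
    rw [← h2] at h3
    linarith
  · rintro ⟨h1, h2⟩
    have h3 : 2 * (Real.log 2 - (b * meanTanh P Y b - meanLogCosh P Y b)) = b ^ 2 := by linarith
    rw [h3]
    exact ⟨sq_nonneg b, (Real.sqrt_sq h1).symm⟩

theorem exists_pos_tangentIntercept_eq_zero (hY : Integrable Y P) :
    ∃ b, 0 < b ∧ tangentIntercept P Y b = 0 := by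
  have hlog := Real.log_pos (by norm_num : (1 : ℝ) < 2)
  have hcont : Continuous (tangentIntercept P Y) :=
    (continuous_annealedLimit hY).sub (continuous_id.mul (continuous_annealedSlope hY))
  have h2 : tangentIntercept P Y 2 ≤ 0 := by
    have h := meanLogCosh_tangent hY 0 2
    rw [meanLogCosh_zero] at h
    have := Real.log_two_lt_d9
    unfold tangentIntercept annealedLimit annealedSlope
    linarith
  obtain ⟨b, hb, hb0⟩ := intermediate_value_Icc' (by norm_num : (0 : ℝ) ≤ 2) hcont.continuousOn
    (show (0 : ℝ) ∈ Set.Icc _ _ from ⟨h2, by rw [tangentIntercept_zero]; exact hlog.le⟩)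
  refine ⟨b, lt_of_le_of_ne hb.1 ?_, hb0⟩
  rintro rfl
  rw [tangentIntercept_zero] at hb0
  exact hlog.ne' hb0

/-- Where the tangent intercept is positive, `annealedLimit (p b) - p * annealedLimit b`, the
exponential rate of the `p`-th moments, is negative for `p > 1` near `1`: its derivative at
`p = 1` is `-tangentIntercept b`. -/
theorem exists_moment_exponent (hY : Integrable Y P) {b : ℝ} (hb : 0 < tangentIntercept P Y b) :
    ∃ p, 1 < p ∧ p ≤ 2 ∧ annealedLimit P Y (p * b) - p * annealedLimit P Y b < 0 := by
  have hc : ContinuousAt (fun p : ℝ => b * annealedSlope P Y (p * b)) 1 :=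
    (continuous_const.mul ((continuous_annealedSlope hY).comp
      (continuous_id.mul continuous_const))).continuousAt
  have hev : ∀ᶠ p in 𝓝[>] (1 : ℝ), b * annealedSlope P Y (p * b) < annealedLimit P Y b := by
    refine (hc.tendsto.mono_left nhdsWithin_le_nhds).eventually (gt_mem_nhds ?_)
    rw [one_mul]
    exact sub_pos.1 hb
  have hp2 : ∀ᶠ p in 𝓝[>] (1 : ℝ), p ≤ 2 :=
    (eventually_le_nhds (by norm_num : (1 : ℝ) < 2)).filter_mono nhdsWithin_le_nhds
  obtain ⟨p, ⟨hp, hp2⟩, hp1⟩ := ((hev.and hp2).and self_mem_nhdsWithin).exists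
  refine ⟨p, hp1, hp2, ?_⟩
  have h1 := annealedLimit_tangent hY b (p * b)
  have h2 : 0 < (p - 1) * (annealedLimit P Y b - b * annealedSlope P Y (p * b)) :=
    mul_pos (sub_pos.2 hp1) (sub_pos.2 hp)
  linarith

end Critical

/-! ### The partition function -/

/-- The partition function `∑ σ, exp (β H(σ))`. -/
noncomputable def partitionFn (N : ℕ) (x : Config N → ℝ) (h : ℕ → ℝ) (β : ℝ) : ℝ :=
  ∑ σ : Config N, Real.exp (β * hamiltonian N x h σ)

variable {N : ℕ} {x : Config N → ℝ} {h : ℕ → ℝ}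

theorem freeEnergy_eq (N : ℕ) (x : Config N → ℝ) (h : ℕ → ℝ) (β : ℝ) :
    freeEnergy N x h β = Real.log (partitionFn N x h β) / N := by
  rw [freeEnergy, partitionFn, one_div_mul_eq_div]

theorem partitionFn_pos (β : ℝ) : 0 < partitionFn N x h β :=
  Finset.sum_pos (fun _ _ => Real.exp_pos _) Finset.univ_nonempty

theorem measurable_partitionFn (N : ℕ) (β : ℝ) :
    Measurable fun z : (Config N → ℝ) × (ℕ → ℝ) => partitionFn N z.1 z.2 β := by
  unfold partitionFn hamiltonian fieldEnergy
  fun_prop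

/-- The `ℓ^p` norm of the Boltzmann weights decreases in `p`. -/
theorem log_partitionFn_le {b β : ℝ} (hb : 0 < b) (hβ : b ≤ β) :
    b * Real.log (partitionFn N x h β) ≤ β * Real.log (partitionFn N x h b) := by
  have hZ := partitionFn_pos (N := N) (x := x) (h := h) b
  set L := Real.log (partitionFn N x h b) with hL
  have hβ0 : 0 < β := hb.trans_le hβ
  have key : partitionFn N x h β ≤ Real.exp (β / b * L) := by
    have hterm : ∀ σ : Config N, Real.exp (β * hamiltonian N x h σ) ≤
        Real.exp ((β / b - 1) * L) * Real.exp (b * hamiltonian N x h σ) := by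
      intro σ
      rw [← Real.exp_add, Real.exp_le_exp]
      have h1 : b * hamiltonian N x h σ ≤ L := by
        rw [hL, Real.le_log_iff_exp_le hZ]
        exact Finset.single_le_sum (f := fun σ : Config N => Real.exp (b * hamiltonian N x h σ))
          (fun _ _ => (Real.exp_pos _).le) (Finset.mem_univ σ)
      have h2 : 0 ≤ β / b - 1 := by
        rw [sub_nonneg, one_le_div hb]
        exact hβ
      have h3 : β * hamiltonian N x h σ =
          (β / b - 1) * (b * hamiltonian N x h σ) + b * hamiltonian N x h σ := by
        field_simp
        ring
      rw [h3]
      linarith [mul_le_mul_of_nonneg_left h1 h2]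
    calc partitionFn N x h β
        ≤ ∑ σ : Config N, Real.exp ((β / b - 1) * L) * Real.exp (b * hamiltonian N x h σ) :=
          Finset.sum_le_sum fun σ _ => hterm σ
      _ = Real.exp ((β / b - 1) * L) * partitionFn N x h b := by
          rw [← Finset.mul_sum, partitionFn]
      _ = Real.exp (β / b * L) := by
          rw [← Real.exp_log hZ, ← hL, ← Real.exp_add]
          congr 1
          ring
  have := (Real.log_le_iff_le_exp (partitionFn_pos β)).2 key
  calc b * Real.log (partitionFn N x h β) ≤ b * (β / b * L) :=
        mul_le_mul_of_nonneg_left this hb.le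
    _ = β * L := by field_simp

/-- Log-convexity of the partition function: the slope of `log Z` over `[a, β]` is at least the
slope over `[a, b]`. -/
theorem log_partitionFn_slope_le {a b β : ℝ} (hab : a < b) (hbβ : b ≤ β) :
    (β - a) * (Real.log (partitionFn N x h b) - Real.log (partitionFn N x h a)) ≤
      (b - a) * (Real.log (partitionFn N x h β) - Real.log (partitionFn N x h a)) := by
  have hA := partitionFn_pos (N := N) (x := x) (h := h) a
  have hB := partitionFn_pos (N := N) (x := x) (h := h) β
  set LA := Real.log (partitionFn N x h a) with hLA
  set LB := Real.log (partitionFn N x h β) with hLB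
  have hpos : 0 < β - a := by linarith
  set θ := (b - a) / (β - a) with hθ
  have hθ0 : 0 ≤ θ := div_nonneg (by linarith) hpos.le
  have hθ1 : θ ≤ 1 := (div_le_one hpos).2 (by linarith)
  have hθmul : θ * (β - a) = b - a := div_mul_cancel₀ _ hpos.ne'
  have key : partitionFn N x h b ≤ Real.exp ((1 - θ) * LA + θ * LB) := by
    have hterm : ∀ σ : Config N, Real.exp (b * hamiltonian N x h σ) ≤
        Real.exp ((1 - θ) * LA + θ * LB) *
          ((1 - θ) * (Real.exp (a * hamiltonian N x h σ) / partitionFn N x h a) +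
            θ * (Real.exp (β * hamiltonian N x h σ) / partitionFn N x h β)) := by
      intro σ
      have hconv := convexOn_exp.2 (Set.mem_univ (a * hamiltonian N x h σ - LA))
        (Set.mem_univ (β * hamiltonian N x h σ - LB)) (sub_nonneg.2 hθ1) hθ0 (by ring)
      simp only [smul_eq_mul] at hconv
      rw [Real.exp_sub, Real.exp_sub, hLA, hLB, Real.exp_log hA, Real.exp_log hB, ← hLA,
        ← hLB] at hconv
      refine le_trans (le_of_eq ?_) (mul_le_mul_of_nonneg_left hconv (Real.exp_pos _).le)
      rw [← Real.exp_add]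
      congr 1
      linear_combination (-hamiltonian N x h σ) * hθmul
    calc partitionFn N x h b ≤ ∑ σ : Config N, _ := Finset.sum_le_sum fun σ _ => hterm σ
      _ = Real.exp ((1 - θ) * LA + θ * LB) := by
        rw [← Finset.mul_sum, Finset.sum_add_distrib, ← Finset.mul_sum, ← Finset.mul_sum,
          ← Finset.sum_div, ← Finset.sum_div]
        change _ * ((1 - θ) * (partitionFn N x h a / partitionFn N x h a) +
          θ * (partitionFn N x h β / partitionFn N x h β)) = _
        rw [div_self hA.ne', div_self hB.ne']
        ring
  have h1 := (Real.log_le_iff_le_exp (partitionFn_pos b)).2 key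
  calc (β - a) * (Real.log (partitionFn N x h b) - LA)
      ≤ (β - a) * (θ * (LB - LA)) := mul_le_mul_of_nonneg_left (by linarith) hpos.le
    _ = (b - a) * (LB - LA) := by rw [← hθmul]; ring

/-- The logarithm of the partition function averaged over Gaussian energies of variance `N`, the
field being fixed. -/
noncomputable def logAnnealed (N : ℕ) (h : ℕ → ℝ) (β : ℝ) : ℝ :=
  N * (Real.log 2 + β ^ 2 / 2) + ∑ i ∈ Finset.range N, Real.log (Real.cosh (β * h i))

theorem measurable_logAnnealed (N : ℕ) (β : ℝ) : Measurable fun h => logAnnealed N h β := by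
  unfold logAnnealed
  have := continuous_log_cosh.measurable
  fun_prop

theorem sum_exp_fieldEnergy (N : ℕ) (h : ℕ → ℝ) (β : ℝ) :
    ∑ σ : Config N, Real.exp (N * β ^ 2 / 2) * Real.exp (β * fieldEnergy N h σ) =
      Real.exp (logAnnealed N h β) := by
  have h1 : ∀ σ : Config N, Real.exp (β * fieldEnergy N h σ) =
      ∏ i : Fin N, Real.exp (β * (h i * ((σ i : ℤ) : ℝ))) := by
    intro σ
    rw [fieldEnergy, Finset.mul_sum, Real.exp_sum]
  have h2 : ∑ σ : Config N, Real.exp (β * fieldEnergy N h σ) =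
      ∏ i : Fin N, (2 * Real.cosh (β * h i)) := by
    simp_rw [h1]
    rw [← Fintype.piFinset_univ, ← Finset.prod_univ_sum (fun _ => Finset.univ)
      fun (i : Fin N) (s : ℤˣ) => Real.exp (β * (h i * ((s : ℤ) : ℝ)))]
    refine Finset.prod_congr rfl fun i _ => ?_
    rw [UnitsInt.univ, Finset.sum_pair (by decide), Real.cosh_eq]
    simp
    ring
  rw [← Finset.mul_sum, h2, Fin.prod_univ_eq_prod_range (fun i => 2 * Real.cosh (β * h i)) N,
    Finset.prod_mul_distrib, logAnnealed, Real.exp_add, Real.exp_sum, mul_add, Real.exp_add]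
  have h3 : Real.exp (N * Real.log 2) = ∏ i ∈ Finset.range N, 2 := by
    rw [Real.exp_nat_mul, Real.exp_log two_pos]
    simp
  rw [h3, Finset.prod_congr rfl fun i _ => Real.exp_log (Real.cosh_pos (β * h i))]
  rw [show (N : ℝ) * (β ^ 2 / 2) = N * β ^ 2 / 2 by ring]
  ring

/-! ### A truncated second moment bound -/

section Probability

variable {Ω : Type*} [MeasurableSpace Ω] {P : Measure Ω} [IsProbabilityMeasure P]

/-- A sum of independent nonnegative variables with mean `1` is unlikely to be below `1 / 2` when
the sum of the `p`-th moments is small for some `p ∈ (1, 2]`: truncating the variables at `1`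
changes the mean by at most the sum of the `p`-th moments, which also bounds the variance. -/
theorem measureReal_sum_le_half {ι : Type*} [Fintype ι] {ξ : ι → Ω → ℝ}
    (hmeas : ∀ i, Measurable (ξ i)) (hnonneg : ∀ i ω, 0 ≤ ξ i ω) (hindep : iIndepFun ξ P)
    {p : ℝ} (hp1 : 1 < p) (hp2 : p ≤ 2) (hint : ∀ i, Integrable (ξ i) P)
    (hintp : ∀ i, Integrable (fun ω => ξ i ω ^ p) P) (hmean : ∑ i, ∫ ω, ξ i ω ∂P = 1) :
    P.real {ω | ∑ i, ξ i ω ≤ 1 / 2} ≤ 16 * ∑ i, ∫ ω, ξ i ω ^ p ∂P := by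
  set M := ∑ i, ∫ ω, ξ i ω ^ p ∂P with hM
  rcases le_or_gt (1 / 16) M with hM16 | hM16
  · exact measureReal_le_one.trans (by linarith)
  set η : ι → Ω → ℝ := fun i ω => min (ξ i ω) 1 with hη
  have ηmeas : ∀ i, Measurable (η i) := fun i => (hmeas i).min measurable_const
  have ηbd : ∀ i ω, ‖η i ω‖ ≤ 1 := fun i ω => by
    rw [Real.norm_eq_abs, abs_of_nonneg (le_min (hnonneg i ω) zero_le_one)]
    exact min_le_right _ _
  have ηLp : ∀ i, MemLp (η i) 2 P := fun i =>
    MemLp.of_bound (ηmeas i).aestronglyMeasurable 1 (ae_of_all _ (ηbd i))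
  have ηint : ∀ i, Integrable (η i) P := fun i => (ηLp i).integrable one_le_two
  have hlow : ∀ i ω, ξ i ω - ξ i ω ^ p ≤ η i ω := by
    intro i ω
    have h0 := Real.rpow_nonneg (hnonneg i ω) p
    rcases le_total (ξ i ω) 1 with h1 | h1
    · simp only [hη, min_eq_left h1]
      linarith
    · have h2 := Real.rpow_le_rpow_of_exponent_le h1 hp1.le
      rw [Real.rpow_one] at h2
      simp only [hη, min_eq_right h1]
      linarith
  have hsq : ∀ i ω, η i ω ^ 2 ≤ ξ i ω ^ p := by
    intro i ω
    rcases le_total (ξ i ω) 1 with h1 | h1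
    · simp only [hη, min_eq_left h1]
      rcases (hnonneg i ω).eq_or_lt with h0 | h0
      · rw [← h0, Real.zero_rpow (by linarith)]
        norm_num
      · rw [← Real.rpow_two]
        exact Real.rpow_le_rpow_of_exponent_ge h0 h1 hp2
    · simp only [hη, min_eq_right h1]
      simpa using Real.one_le_rpow h1 (by linarith)
  set S : Ω → ℝ := ∑ i, η i with hS
  have hSapply : ∀ ω, S ω = ∑ i, η i ω := fun ω => by rw [hS, Finset.sum_apply]
  have hSLp : MemLp S 2 P := memLp_finsetSum' _ fun i _ => ηLp i
  have hES : 1 - M ≤ ∫ ω, S ω ∂P := by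
    simp_rw [hSapply]
    rw [integral_finsetSum _ fun i _ => ηint i, hM, ← hmean, ← Finset.sum_sub_distrib]
    refine Finset.sum_le_sum fun i _ => ?_
    rw [← integral_sub (hint i) (hintp i)]
    exact integral_mono ((hint i).sub (hintp i)) (ηint i) (hlow i)
  have hVar : Var[S; P] ≤ M := by
    have ηindep : iIndepFun η P :=
      hindep.comp (fun _ y => min y 1) fun _ => measurable_id.min measurable_const
    rw [hS, IndepFun.variance_sum (fun i _ => ηLp i) fun i _ j _ hij => ηindep.indepFun hij]
    refine Finset.sum_le_sum fun i _ => ?_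
    refine (variance_le_expectation_sq (ηmeas i).aestronglyMeasurable).trans ?_
    exact integral_mono (ηLp i).integrable_sq (hintp i) (hsq i)
  have hcheb := meas_ge_le_variance_div_sq hSLp (by norm_num : (0 : ℝ) < 1 / 4)
  have hsub : {ω | ∑ i, ξ i ω ≤ 1 / 2} ⊆ {ω | 1 / 4 ≤ |S ω - ∫ ω', S ω' ∂P|} := by
    intro ω hω
    have h1 : S ω ≤ ∑ i, ξ i ω := by
      rw [hSapply]
      exact Finset.sum_le_sum fun i _ => min_le_left _ _
    have h2 : ∑ i, ξ i ω ≤ 1 / 2 := hω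
    change 1 / 4 ≤ |S ω - ∫ ω', S ω' ∂P|
    rw [abs_sub_comm]
    exact le_trans (by linarith) (le_abs_self _)
  refine (measureReal_mono hsub).trans ?_
  refine (ENNReal.toReal_le_of_le_ofReal (by have := variance_nonneg S P; positivity) hcheb).trans ?_
  rw [div_le_iff₀ (by norm_num)]
  linarith

/-- If `U` and `V` are independent and each section of `S` over a value of `V` has probability at
most `c`, then `S` has probability at most `c`. -/
theorem measure_mem_le_of_indepFun {α γ : Type*} [MeasurableSpace α] [MeasurableSpace γ]
    {U : Ω → α} {V : Ω → γ} (hU : Measurable U) (hV : Measurable V) (hUV : IndepFun U V P)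
    {S : Set (α × γ)} (hS : MeasurableSet S) {c : ENNReal} (hc : ∀ v, P {ω | (U ω, v) ∈ S} ≤ c) :
    P {ω | (U ω, V ω) ∈ S} ≤ c := by
  have := Measure.isProbabilityMeasure_map (μ := P) hU.aemeasurable
  have := Measure.isProbabilityMeasure_map (μ := P) hV.aemeasurable
  have h1 := (indepFun_iff_map_prod_eq_prod_map_map hU.aemeasurable hV.aemeasurable).1 hUV
  calc P {ω | (U ω, V ω) ∈ S} = P.map (fun ω => (U ω, V ω)) S :=
        (Measure.map_apply (hU.prodMk hV) hS).symm
    _ = ∫⁻ v, P.map U ((fun u => (u, v)) ⁻¹' S) ∂(P.map V) := by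
        rw [h1, Measure.prod_apply_symm hS]
    _ ≤ ∫⁻ _, c ∂(P.map V) := by
        refine lintegral_mono fun v => ?_
        rw [Measure.map_apply hU (measurable_prodMk_right hS)]
        exact hc v
    _ = c := by simp

end Probability

/-! ### The partition function in a fixed field -/

section FixedField

variable {Ω : Type*} [MeasurableSpace Ω] {P : Measure Ω} {N : ℕ} {U : Config N → Ω → ℝ}

theorem integral_exp_hamiltonian (hlaw : ∀ σ, HasLaw (U σ) (gaussianReal 0 (N : NNReal)) P)
    (v : ℕ → ℝ) (β : ℝ) (σ : Config N) :
    ∫ ω, Real.exp (β * hamiltonian N (fun τ => U τ ω) v σ) ∂P =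
      Real.exp (N * β ^ 2 / 2) * Real.exp (β * fieldEnergy N v σ) := by
  have h1 := mgf_gaussianReal (hlaw σ).map_eq β
  simp only [hamiltonian, mul_add, Real.exp_add, integral_mul_const]
  rw [mgf] at h1
  rw [h1]
  simp

theorem integrable_exp_hamiltonian (hlaw : ∀ σ, HasLaw (U σ) (gaussianReal 0 (N : NNReal)) P)
    (v : ℕ → ℝ) (β : ℝ) (σ : Config N) :
    Integrable (fun ω => Real.exp (β * hamiltonian N (fun τ => U τ ω) v σ)) P := by
  simp only [hamiltonian, mul_add, Real.exp_add]
  refine Integrable.mul_const ?_ _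
  have h1 := integrable_exp_mul_gaussianReal (μ := 0) (v := (N : NNReal)) β
  rw [← (hlaw σ).map_eq] at h1
  exact h1.comp_aemeasurable (hlaw σ).aemeasurable

theorem integral_partitionFn (hlaw : ∀ σ, HasLaw (U σ) (gaussianReal 0 (N : NNReal)) P)
    (v : ℕ → ℝ) (β : ℝ) :
    ∫ ω, partitionFn N (fun τ => U τ ω) v β ∂P = Real.exp (logAnnealed N v β) := by
  unfold partitionFn
  rw [integral_finsetSum _ fun σ _ => integrable_exp_hamiltonian hlaw v β σ,
    ← sum_exp_fieldEnergy]
  exact Finset.sum_congr rfl fun σ _ => integral_exp_hamiltonian hlaw v β σ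

/-- Markov's inequality for the partition function in a fixed field. -/
theorem measureReal_partitionFn_ge_le
    (hlaw : ∀ σ, HasLaw (U σ) (gaussianReal 0 (N : NNReal)) P) (v : ℕ → ℝ) (β r : ℝ) :
    P.real {ω | Real.exp (r + logAnnealed N v β) ≤ partitionFn N (fun τ => U τ ω) v β} ≤
      Real.exp (-r) := by
  have h1 := mul_meas_ge_le_integral_of_nonneg
    (ae_of_all P fun ω => (partitionFn_pos (x := fun τ => U τ ω) (h := v) β).le)
    (integrable_finsetSum _ fun σ _ => integrable_exp_hamiltonian hlaw v β σ)
    (Real.exp (r + logAnnealed N v β))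
  rw [integral_partitionFn hlaw, Real.exp_add, mul_assoc, mul_left_comm] at h1
  have h2 := le_of_mul_le_mul_left (h1.trans_eq (mul_one _).symm) (Real.exp_pos _)
  rw [Real.exp_neg, ← one_div, le_div_iff₀' (Real.exp_pos r), Real.exp_add]
  exact h2

/-- The truncated second moment bound for the Boltzmann weights divided by the mean of the partition
function. -/
theorem measureReal_partitionFn_le_half_le [IsProbabilityMeasure P]
    (hmeas : ∀ σ, Measurable (U σ)) (hindep : iIndepFun U P)
    (hlaw : ∀ σ, HasLaw (U σ) (gaussianReal 0 (N : NNReal)) P) (v : ℕ → ℝ) (β : ℝ) {p : ℝ}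
    (hp1 : 1 < p) (hp2 : p ≤ 2) :
    P.real {ω | partitionFn N (fun τ => U τ ω) v β ≤ 1 / 2 * Real.exp (logAnnealed N v β)} ≤
      16 * Real.exp (logAnnealed N v (p * β) - p * logAnnealed N v β) := by
  set A := logAnnealed N v β with hA
  set ξ : Config N → Ω → ℝ := fun σ ω =>
    Real.exp (-A) * Real.exp (β * hamiltonian N (fun τ => U τ ω) v σ) with hξ
  have hξp : ∀ σ ω, ξ σ ω ^ p =
      Real.exp (-(p * A)) * Real.exp (p * β * hamiltonian N (fun τ => U τ ω) v σ) := by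
    intro σ ω
    rw [hξ]
    simp only
    rw [← Real.exp_add, ← Real.exp_mul, ← Real.exp_add]
    congr 1
    ring
  have hξmeas : ∀ σ, Measurable fun y : ℝ =>
      Real.exp (-A) * Real.exp (β * (y + fieldEnergy N v σ)) := fun σ => by fun_prop
  have key := measureReal_sum_le_half (P := P) (ξ := ξ) (p := p)
    (fun σ => (hξmeas σ).comp (hmeas σ))
    (fun σ ω => (mul_pos (Real.exp_pos _) (Real.exp_pos _)).le)
    (hindep.comp _ hξmeas) hp1 hp2
    (fun σ => (integrable_exp_hamiltonian hlaw v β σ).const_mul _)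
    (fun σ => by
      simp only [hξp]
      exact (integrable_exp_hamiltonian hlaw v (p * β) σ).const_mul _)
    (by
      simp only [hξ, integral_const_mul, integral_exp_hamiltonian hlaw]
      rw [← Finset.mul_sum, sum_exp_fieldEnergy, ← Real.exp_add, ← hA, neg_add_cancel,
        Real.exp_zero])
  simp only [hξp, integral_const_mul, integral_exp_hamiltonian hlaw] at key
  rw [← Finset.mul_sum, sum_exp_fieldEnergy, ← Real.exp_add] at key
  rw [sub_eq_neg_add]
  refine le_trans (le_of_eq ?_) key
  congr 1
  ext ω
  simp only [Set.mem_ofPred_eq, hξ]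
  rw [← Finset.mul_sum, ← partitionFn, Real.exp_neg, inv_mul_le_iff₀ (Real.exp_pos A), mul_comm]

end FixedField

/-! ### Almost sure asymptotics of the free energy -/

section AlmostSure

variable {Ω : Type*} [MeasurableSpace Ω] {P : Measure Ω}

theorem ae_tendsto_of_forall_ae {f : ℕ → Ω → ℝ} {a : ℝ}
    (hlo : ∀ ε > 0, ∀ᵐ ω ∂P, ∀ᶠ N in atTop, a - ε ≤ f N ω)
    (hhi : ∀ ε > 0, ∀ᵐ ω ∂P, ∀ᶠ N in atTop, f N ω ≤ a + ε) :
    ∀ᵐ ω ∂P, Tendsto (fun N => f N ω) atTop (𝓝 a) := by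
  have h1 := ae_all_iff.2 fun k : ℕ => hlo (1 / (k + 1)) Nat.one_div_pos_of_nat
  have h2 := ae_all_iff.2 fun k : ℕ => hhi (1 / (k + 1)) Nat.one_div_pos_of_nat
  filter_upwards [h1, h2] with ω h1 h2
  refine tendsto_order.2 ⟨fun b hb => ?_, fun b hb => ?_⟩
  · obtain ⟨k, hk⟩ := exists_nat_one_div_lt (sub_pos.2 hb)
    filter_upwards [h1 k] with N hN
    linarith
  · obtain ⟨k, hk⟩ := exists_nat_one_div_lt (sub_pos.2 hb)
    filter_upwards [h2 k] with N hN
    linarith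

variable {h : ℕ → Ω → ℝ} {X : (N : ℕ) → Config N → Ω → ℝ}

/-- The law of large numbers for the annealed free energy in the random field. -/
theorem ae_tendsto_logAnnealed_div (h_indep : iIndepFun h P)
    (h_ident : ∀ i, IdentDistrib (h i) (h 0) P P) (h_int : Integrable (h 0) P) (t : ℝ) :
    ∀ᵐ ω ∂P, Tendsto (fun N : ℕ => logAnnealed N (fun i => h i ω) t / N) atTop
      (𝓝 (annealedLimit P (h 0) t)) := by
  have hg : Measurable fun y : ℝ => Real.log (Real.cosh (t * y)) :=
    continuous_log_cosh.measurable.comp (measurable_id.const_mul t)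
  have hlln := strong_law_ae_real (fun i ω => Real.log (Real.cosh (t * h i ω)))
    (integrable_log_cosh h_int t)
    (fun i j hij => (h_indep.indepFun hij).comp hg hg) fun i => (h_ident i).comp hg
  filter_upwards [hlln] with ω hω
  refine (hω.const_add (Real.log 2 + t ^ 2 / 2)).congr' ?_
  filter_upwards [eventually_gt_atTop 0] with N hN
  have : (N : ℝ) ≠ 0 := by positivity
  rw [logAnnealed]
  field_simp

variable [IsProbabilityMeasure P]

/-- A Borel–Cantelli lemma: the joint law of the energies for different `N` is irrelevant, and it
is enough to bound the probabilities of the bad events uniformly in a fixed field `v`. -/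
theorem ae_eventually_notMem_of_indepFun (h_meas : ∀ i, Measurable (h i))
    (X_meas : ∀ N σ, Measurable (X N σ))
    (X_indep_h : ∀ N, 0 < N → IndepFun (fun ω σ => X N σ ω) (fun ω i => h i ω) P)
    {S : (N : ℕ) → Set ((Config N → ℝ) × (ℕ → ℝ))} (hS : ∀ N, MeasurableSet (S N)) {C r : ℝ}
    (hC : 1 ≤ C) (hr : 0 < r)
    (hbound : ∀ N, 0 < N → ∀ v,
      P.real {ω | ((fun σ => X N σ ω), v) ∈ S N} ≤ C * Real.exp (-(r * N))) :
    ∀ᵐ ω ∂P, ∀ᶠ N in atTop, ((fun σ => X N σ ω), fun i => h i ω) ∉ S N := by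
  refine ae_eventually_notMem (s := fun N => {ω | ((fun σ => X N σ ω), fun i => h i ω) ∈ S N}) ?_
  have hle : ∀ N, P {ω | ((fun σ => X N σ ω), fun i => h i ω) ∈ S N} ≤
      ENNReal.ofReal (C * Real.exp (-(r * N))) := by
    intro N
    rcases N.eq_zero_or_pos with rfl | hN
    · refine prob_le_one.trans ?_
      simpa using ENNReal.ofReal_le_ofReal hC
    · refine measure_mem_le_of_indepFun (measurable_pi_lambda _ (X_meas N))
        (measurable_pi_lambda _ h_meas) (X_indep_h N hN) (hS N) fun v => ?_
      rw [← ofReal_measureReal]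
      exact ENNReal.ofReal_le_ofReal (hbound N hN v)
  have hsum : Summable fun N : ℕ => C * Real.exp (-(r * N)) := by
    refine Summable.mul_left C ?_
    simpa [mul_comm] using Real.summable_exp_nat_mul_iff.2 (neg_lt_zero.2 hr)
  exact ne_top_of_le_ne_top hsum.tsum_ofReal_ne_top (ENNReal.tsum_le_tsum hle)

/-- The annealed upper bound, at every inverse temperature. -/
theorem ae_eventually_freeEnergy_le (h_meas : ∀ i, Measurable (h i)) (h_indep : iIndepFun h P)
    (h_ident : ∀ i, IdentDistrib (h i) (h 0) P P) (h_int : Integrable (h 0) P)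
    (X_meas : ∀ N σ, Measurable (X N σ))
    (X_law : ∀ N, 0 < N → ∀ σ, HasLaw (X N σ) (gaussianReal 0 (N : NNReal)) P)
    (X_indep_h : ∀ N, 0 < N → IndepFun (fun ω σ => X N σ ω) (fun ω i => h i ω) P)
    (β ε : ℝ) (hε : 0 < ε) :
    ∀ᵐ ω ∂P, ∀ᶠ N in atTop, freeEnergy N (fun σ => X N σ ω) (fun i => h i ω) β ≤
      annealedLimit P (h 0) β + ε := by
  have hbc := ae_eventually_notMem_of_indepFun (P := P) h_meas X_meas X_indep_h
    (S := fun N => {z | Real.exp (ε / 2 * N + logAnnealed N z.2 β) ≤ partitionFn N z.1 z.2 β})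
    (fun N => measurableSet_le
      (((measurable_logAnnealed N β).comp measurable_snd).const_add _).exp
      (measurable_partitionFn N β)) le_rfl (half_pos hε)
    (fun N hN v => (measureReal_partitionFn_ge_le (X_law N hN) v β _).trans_eq (one_mul _).symm)
  filter_upwards [hbc, ae_tendsto_logAnnealed_div h_indep h_ident h_int β] with ω h1 h2
  filter_upwards [h1, h2.eventually_lt_const
    (lt_add_of_pos_right (annealedLimit P (h 0) β) (half_pos hε)),
    eventually_gt_atTop 0] with N hN hN2 hN0
  have hN0' : (0 : ℝ) < N := by exact_mod_cast hN0
  replace hN := not_le.1 hN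
  have h3 := (Real.log_le_iff_le_exp (partitionFn_pos β)).2 hN.le
  rw [freeEnergy_eq, div_le_iff₀ hN0']
  rw [div_lt_iff₀ hN0'] at hN2
  linarith

/-- The matching lower bound at inverse temperatures where the tangent intercept is positive. -/
theorem ae_eventually_le_freeEnergy (h_meas : ∀ i, Measurable (h i)) (h_indep : iIndepFun h P)
    (h_ident : ∀ i, IdentDistrib (h i) (h 0) P P) (h_int : Integrable (h 0) P)
    (X_meas : ∀ N σ, Measurable (X N σ)) (X_indep : ∀ N, 0 < N → iIndepFun (X N) P)
    (X_law : ∀ N, 0 < N → ∀ σ, HasLaw (X N σ) (gaussianReal 0 (N : NNReal)) P)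
    (X_indep_h : ∀ N, 0 < N → IndepFun (fun ω σ => X N σ ω) (fun ω i => h i ω) P)
    {β : ℝ} (hβ : 0 < tangentIntercept P (h 0) β) {ε : ℝ} (hε : 0 < ε) :
    ∀ᵐ ω ∂P, ∀ᶠ N in atTop, annealedLimit P (h 0) β - ε ≤
      freeEnergy N (fun σ => X N σ ω) (fun i => h i ω) β := by
  obtain ⟨p, hp1, hp2, hp⟩ := exists_moment_exponent h_int hβ
  obtain ⟨r, hr, hpr⟩ : ∃ r, 0 < r ∧
      annealedLimit P (h 0) (p * β) - p * annealedLimit P (h 0) β < -r :=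
    ⟨_, half_pos (neg_pos.2 hp), by linarith⟩
  -- The bad event is restricted to fields in which the `p`-th moments are already exponentially
  -- small; almost surely this restriction holds for all large `N`.
  have hbc := ae_eventually_notMem_of_indepFun (P := P) h_meas X_meas X_indep_h
    (S := fun N => {z | partitionFn N z.1 z.2 β ≤ 1 / 2 * Real.exp (logAnnealed N z.2 β)} ∩
      {z | logAnnealed N z.2 (p * β) - p * logAnnealed N z.2 β ≤ -(r * N)})
    (fun N => by
      have m1 := (measurable_logAnnealed N β).comp
        (measurable_snd : Measurable (Prod.snd : (Config N → ℝ) × (ℕ → ℝ) → ℕ → ℝ))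
      have m2 := (measurable_logAnnealed N (p * β)).comp
        (measurable_snd : Measurable (Prod.snd : (Config N → ℝ) × (ℕ → ℝ) → ℕ → ℝ))
      exact (measurableSet_le (measurable_partitionFn N β) (m1.exp.const_mul _)).inter
        (measurableSet_le (m2.sub (m1.const_mul p)) measurable_const))
    (by norm_num : (1 : ℝ) ≤ 16) hr
    (fun N hN v => by
      by_cases hv : logAnnealed N v (p * β) - p * logAnnealed N v β ≤ -(r * N)
      · refine (measureReal_mono fun ω hω => hω.1).trans
          ((measureReal_partitionFn_le_half_le (X_meas N) (X_indep N hN) (X_law N hN) v β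
            hp1 hp2).trans ?_)
        gcongr
      · have : {ω | ((fun σ => X N σ ω), v) ∈
            {z | partitionFn N z.1 z.2 β ≤ 1 / 2 * Real.exp (logAnnealed N z.2 β)} ∩
            {z | logAnnealed N z.2 (p * β) - p * logAnnealed N z.2 β ≤ -(r * N)}} = ∅ :=
          Set.eq_empty_of_forall_notMem fun ω hω => hv hω.2
        rw [this, measureReal_empty]
        positivity)
  filter_upwards [hbc, ae_tendsto_logAnnealed_div h_indep h_ident h_int β,
    ae_tendsto_logAnnealed_div h_indep h_ident h_int (p * β)] with ω h1 h2 h3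
  have h4 := (h3.sub (h2.const_mul p)).eventually_lt_const hpr
  have h5 := h2.sub ((tendsto_const_div_atTop_nhds_zero_nat (Real.log 2)))
  rw [sub_zero] at h5
  filter_upwards [h1, h4, h5.eventually_const_lt (sub_lt_self _ hε), eventually_gt_atTop 0]
    with N hN1 hN4 hN5 hN0
  have hN0' : (0 : ℝ) < N := by exact_mod_cast hN0
  have hlarge : 1 / 2 * Real.exp (logAnnealed N (fun i => h i ω) β) <
      partitionFn N (fun σ => X N σ ω) (fun i => h i ω) β := by
    by_contra hcon
    refine hN1 ⟨not_lt.1 hcon, ?_⟩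
    rw [← mul_div_assoc, ← sub_div, div_lt_iff₀ hN0'] at hN4
    exact (hN4.trans_eq (neg_mul r N)).le
  have hlog := Real.log_le_log (by positivity) hlarge.le
  rw [Real.log_mul (by norm_num) (Real.exp_pos _).ne', Real.log_exp, one_div, Real.log_inv] at hlog
  refine hN5.le.trans ?_
  rw [freeEnergy_eq, ← sub_div]
  gcongr
  linarith

end AlmostSure

end RandomFieldREM

open RandomFieldREM

theorem theorem1 {Ω : Type*} [MeasurableSpace Ω] (P : Measure Ω) [IsProbabilityMeasure P]
    (h : ℕ → Ω → ℝ) (X : (N : ℕ) → RandomFieldREM.Config N → Ω → ℝ)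
    -- the field: i.i.d. real random variables with all exponential moments
    (h_meas : ∀ i, Measurable (h i))
    (h_indep : iIndepFun h P)
    (h_ident : ∀ i, IdentDistrib (h i) (h 0) P P)
    (h_exp : ∀ t : ℝ, Integrable (fun ω => Real.exp (t * h 0 ω)) P)
    -- the REM energies: for each size `N`, i.i.d. centered Gaussians of variance `N`
    (X_meas : ∀ N σ, Measurable (X N σ))
    (X_indep : ∀ N, 0 < N → iIndepFun (X N) P)
    (X_law : ∀ N, 0 < N → ∀ σ, HasLaw (X N σ) (gaussianReal 0 (N : NNReal)) P)
    -- for each size `N`, the REM energies are independent of the whole field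
    (X_indep_h : ∀ N, 0 < N → IndepFun (fun ω σ => X N σ ω) (fun ω i => h i ω) P) :
    -- the expectations in the formulas are expectations of integrable variables
    (∀ t : ℝ, Integrable (fun ω => Real.log (Real.cosh (t * h 0 ω))) P ∧
      Integrable (fun ω => h 0 ω * Real.tanh (t * h 0 ω)) P) ∧
    ∃ βc : ℝ, 0 < βc ∧
      RandomFieldREM.SelfConsistent P (h 0) βc ∧
      (∀ b : ℝ, RandomFieldREM.SelfConsistent P (h 0) b → b = βc) ∧
      (∀ β : ℝ, 0 < β → β ≤ βc → ∀ᵐ ω ∂P,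
        Tendsto (fun N : ℕ =>
            RandomFieldREM.freeEnergy N (fun σ => X N σ ω) (fun i => h i ω) β) atTop
          (𝓝 (Real.log 2 + β ^ 2 / 2 + RandomFieldREM.meanLogCosh P (h 0) β))) ∧
      (∀ β : ℝ, βc ≤ β → ∀ᵐ ω ∂P,
        Tendsto (fun N : ℕ =>
            RandomFieldREM.freeEnergy N (fun σ => X N σ ω) (fun i => h i ω) β) atTop
          (𝓝 ((βc + RandomFieldREM.meanTanh P (h 0) βc) * β))) := by
  have h_int : Integrable (h 0) P := integrable_of_integrable_exp (h_meas 0) h_exp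
  refine ⟨fun t => ⟨integrable_log_cosh h_int t, integrable_mul_tanh h_int t⟩, ?_⟩
  obtain ⟨βc, hβc, hzero⟩ := exists_pos_tangentIntercept_eq_zero h_int
  have hupper : ∀ β ε : ℝ, 0 < ε → ∀ᵐ ω ∂P, ∀ᶠ N in atTop,
      freeEnergy N (fun σ => X N σ ω) (fun i => h i ω) β ≤ annealedLimit P (h 0) β + ε :=
    ae_eventually_freeEnergy_le h_meas h_indep h_ident h_int X_meas X_law X_indep_h
  have hhigh : ∀ β : ℝ, 0 < β → β < βc → ∀ᵐ ω ∂P,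
      Tendsto (fun N : ℕ => freeEnergy N (fun σ => X N σ ω) (fun i => h i ω) β) atTop
        (𝓝 (annealedLimit P (h 0) β)) := by
    intro β hβ hlt
    refine ae_tendsto_of_forall_ae (fun ε hε => ?_) (hupper β)
    refine ae_eventually_le_freeEnergy h_meas h_indep h_ident h_int X_meas X_indep X_law
      X_indep_h ?_ hε
    rw [← hzero]
    exact strictAntiOn_tangentIntercept h_int hβ hβc hlt
  -- the tangent to the annealed limit at `βc` passes through the origin
  have htangent : annealedLimit P (h 0) βc = annealedSlope P (h 0) βc * βc := by
    unfold tangentIntercept at hzero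
    linarith
  have hlow : ∀ β : ℝ, βc ≤ β → ∀ᵐ ω ∂P,
      Tendsto (fun N : ℕ => freeEnergy N (fun σ => X N σ ω) (fun i => h i ω) β) atTop
        (𝓝 (annealedSlope P (h 0) βc * β)) := by
    intro β hβ
    have hβ0 : 0 < β := hβc.trans_le hβ
    refine ae_tendsto_of_forall_ae (fun ε hε => ?_) fun ε hε => ?_
    · -- tangents at points `a < βc` close to `βc`, evaluated at `β`
      have hc : ContinuousAt (fun a => annealedLimit P (h 0) a +
          (β - a) * annealedSlope P (h 0) a) βc :=
        ((continuous_annealedLimit h_int).add ((continuous_const.sub continuous_id).mul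
          (continuous_annealedSlope h_int))).continuousAt
      have hev : ∀ᶠ a in 𝓝[<] βc, annealedSlope P (h 0) βc * β - ε <
          annealedLimit P (h 0) a + (β - a) * annealedSlope P (h 0) a := by
        refine (hc.tendsto.mono_left nhdsWithin_le_nhds).eventually (lt_mem_nhds ?_)
        rw [htangent]
        linarith
      have hpos : ∀ᶠ a in 𝓝[<] βc, 0 < a :=
        (lt_mem_nhds hβc).filter_mono nhdsWithin_le_nhds
      obtain ⟨a, ⟨ha, ha0⟩, hac⟩ := ((hev.and hpos).and self_mem_nhdsWithin).exists
      obtain ⟨b, hab, hbc⟩ := exists_between (show a < βc from hac)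
      filter_upwards [hhigh a ha0 hac, hhigh b (ha0.trans hab) hbc] with ω h1 h2
      have hchord : Tendsto (fun N : ℕ => freeEnergy N (fun σ => X N σ ω) (fun i => h i ω) a +
          (β - a) * (freeEnergy N (fun σ => X N σ ω) (fun i => h i ω) b -
            freeEnergy N (fun σ => X N σ ω) (fun i => h i ω) a) / (b - a)) atTop
          (𝓝 (annealedLimit P (h 0) a + (β - a) *
            (annealedLimit P (h 0) b - annealedLimit P (h 0) a) / (b - a))) :=
        h1.add (((h2.sub h1).const_mul (β - a)).div_const (b - a))
      have hba : 0 < b - a := sub_pos.2 hab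
      have hlim : annealedSlope P (h 0) βc * β - ε < annealedLimit P (h 0) a + (β - a) *
          (annealedLimit P (h 0) b - annealedLimit P (h 0) a) / (b - a) := by
        refine ha.trans_le ?_
        gcongr
        rw [le_div_iff₀ hba, mul_assoc]
        refine mul_le_mul_of_nonneg_left ?_ (by linarith)
        linarith [annealedLimit_tangent (P := P) (Y := h 0) h_int b a]
      filter_upwards [hchord.eventually_const_lt hlim, eventually_gt_atTop 0] with N hN hN0
      refine hN.le.trans ?_
      have hN0' : (0 : ℝ) < N := by exact_mod_cast hN0
      have hslope := log_partitionFn_slope_le (x := fun σ => X N σ ω) (h := fun i => h i ω)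
        hab (hbc.le.trans hβ)
      rw [← le_sub_iff_add_le', div_le_iff₀ hba]
      simp only [freeEnergy_eq, ← sub_div]
      rw [← mul_div_assoc, div_mul_eq_mul_div]
      exact div_le_div_of_nonneg_right (hslope.trans_eq (mul_comm _ _)) hN0'.le
    · filter_upwards [hupper βc (βc / β * ε) (by positivity)] with ω hω
      filter_upwards [hω, eventually_gt_atTop 0] with N hN hN0
      have hN0' : (0 : ℝ) < N := by exact_mod_cast hN0
      have hmono := log_partitionFn_le (x := fun σ => X N σ ω) (h := fun i => h i ω) hβc hβ
      rw [freeEnergy_eq, htangent, div_le_iff₀ hN0'] at hN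
      rw [freeEnergy_eq, div_le_iff₀ hN0']
      refine le_of_mul_le_mul_left (hmono.trans ?_) hβc
      refine (mul_le_mul_of_nonneg_left hN hβ0.le).trans_eq ?_
      field_simp
  refine ⟨βc, hβc, (selfConsistent_iff βc).2 ⟨hβc.le, hzero⟩, fun b hb => ?_,
    fun β hβ hle => ?_, hlow⟩
  · obtain ⟨hb0, hbz⟩ := (selfConsistent_iff b).1 hb
    have hbpos : 0 < b := by
      refine lt_of_le_of_ne hb0 ?_
      rintro rfl
      rw [tangentIntercept_zero] at hbz
      exact (Real.log_pos one_lt_two).ne' hbz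
    exact (strictAntiOn_tangentIntercept h_int).injOn hbpos hβc (hbz.trans hzero.symm)
  · rcases hle.lt_or_eq with hlt | rfl
    · exact hhigh β hβ hlt
    · rw [← annealedLimit, htangent]
      exact hlow β le_rfl
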